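/- For a prime $p$ and $x \in \mathbb F_p$ let $T(x)$ denote the image in $\operatorname{PSL}_2(p) = \operatorname{SL}_2(\mathbb F_p)/\{\pm 1\}$ of the matrix $\begin{pmatrix} x & -1 \\ 1 & 0 \end{pmatrix}$. For a subset $S$ of a group and $m \geq 1$, let $S^mS^{-m}$ be the set of all elements $g_1 \cdots g_m g_{m+1}^{-1} \cdots g_{2m}^{-1}$ with $g_1, \ldots, g_{2m} \in S$, and let $S^{-m}S^m$ be the set of all elements $g_1^{-1} \cdots g_m^{-1} g_{m+1} \cdots g_{2m}$ with $g_1, \ldots, g_{2m} \in S$; $\langle X \rangle$ is the subgroup generated by $X$. Let $v \neq v'$ be integers and put $C(v,v') = \max(5, |v-v'|+1)$. (1) Let $p \geq C(v,v')$ be a prime, let $\lambda \in \mathbb F_p$ and let $S = \{T(\lambda - v), T(\lambda - v')\}$. Then $\langle S^2S^{-2} \rangle = \langle S^{-2}S^2 \rangle = \operatorname{PSL}_2(p)$. (2) Let $p_1, \ldots, p_k \geq C(v,v')$ be (not necessarily distinct) primes, and let $\lambda_1 \in \mathbb F_{p_1}, \ldots, \lambda_k \in \mathbb F_{p_k}$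 be such that $\lambda_i \neq \lambda_j$ whenever $p_i = p_j$ and $i \neq j$. Let $S = \{(T(\lambda_1 - v), \ldots, T(\lambda_k - v)), (T(\lambda_1 - v'), \ldots, T(\lambda_k - v'))\}$. Then $\langle S^3S^{-3} \rangle = \langle S^{-3}S^3 \rangle = \operatorname{PSL}_2(p_1) \times \cdots \times \operatorname{PSL}_2(p_k)$. -/

import Mathlib

open scoped MatrixGroups Pointwise

/-- The transfer matrix `T(x) = (x, -1; 1, 0)` over a commutative ring, as an element of `SL₂`. -/
def transferSL {R : Type*} [CommRing R] (x : R) : SL(2, R) :=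
  ⟨!![x, -1; 1, 0], by simp [Matrix.det_fin_two]⟩

/-- The image of the transfer matrix `T(x)`, `x ∈ 𝔽_p`, in `PSL₂(p)`. -/
def transferPSL {p : ℕ} (x : ZMod p) : PSL(2, ZMod p) :=
  QuotientGroup.mk (transferSL x)

/-- The two-element set `{T(lam - v), T(lam - v')}` in `PSL₂(p)`. -/
def genSet {p : ℕ} (v v' : ℤ) (lam : ZMod p) : Set (PSL(2, ZMod p)) :=
  {transferPSL (lam - (v : ZMod p)), transferPSL (lam - (v' : ZMod p))}

/-- The set consisting of the two tuples `(T(lam j - v))_j` and `(T(lam j - v'))_j` in the direct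
product of the groups `PSL₂(p j)`. -/
def genSetProd {k : ℕ} {p : Fin k → ℕ} (v v' : ℤ) (lam : (j : Fin k) → ZMod (p j)) :
    Set ((j : Fin k) → PSL(2, ZMod (p j))) :=
  {fun j => transferPSL (lam j - (v : ZMod (p j))),
    fun j => transferPSL (lam j - (v' : ZMod (p j)))}

/-! Since T(x)T(y)⁻¹ = `upper (x - y)`, the generators A, B satisfy AB⁻¹ = `upper d` in every
coordinate, where d = v' - v. As |v - v'| < p, d is nonzero mod p, so within one factor its powers
exhaust the upper unipotents. Conjugating by A supplies the lower ones, which proves part (1).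

For part (2) the factors are perfect, so commutators reduce the claim to pairs of coordinates
(`eq_top_of_pairwise`), where a Goursat kernel (`fstKernel`) has to be everything. Distinct primes
are separated by a power of `upper d`. For equal primes the first two words only yield the graph of
an inner automorphism; the word A²(AB⁻¹)A⁻², available from length 3 on, leaves this graph when the
parameters differ (`fstKernel_eq_top_of_ne`).

Conjugation by the Weyl element turns inverses of transfer matrices into transfer matrices, which
settles the words S⁻ᵐSᵐ. -/

namespace TransferPSL

open Subgroup

/-! ### Unipotent and Weyl elements of PSL₂ over a ring -/

section Generators

variable {R : Type*} [CommRing R]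

/-- The upper unipotent matrix with entry `x`. -/
def upperSL (x : R) : SL(2, R) :=
  ⟨!![1, x; 0, 1], by simp [Matrix.det_fin_two]⟩

/-- The lower unipotent matrix with entry `x`. -/
def lowerSL (x : R) : SL(2, R) :=
  ⟨!![1, 0; x, 1], by simp [Matrix.det_fin_two]⟩

/-- The Weyl element of `SL₂`. -/
def weylSL : SL(2, R) :=
  ⟨!![0, -1; 1, 0], by simp [Matrix.det_fin_two]⟩

/-- The image in `PSL₂` of the upper unipotent matrix with entry `x`. -/
def upper (x : R) : PSL(2, R) :=
  QuotientGroup.mk (upperSL x)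

/-- The image in `PSL₂` of the lower unipotent matrix with entry `x`. -/
def lower (x : R) : PSL(2, R) :=
  QuotientGroup.mk (lowerSL x)

/-- The image in `PSL₂` of the Weyl element. -/
def weyl : PSL(2, R) :=
  QuotientGroup.mk weylSL

lemma mk_mul_mk (A B : SL(2, R)) :
    (QuotientGroup.mk A : PSL(2, R)) * QuotientGroup.mk B = QuotientGroup.mk (A * B) :=
  rfl

lemma mk_mul_eq {A B C : SL(2, R)} (h : A.1 * B.1 = C.1) :
    (QuotientGroup.mk A : PSL(2, R)) * QuotientGroup.mk B = QuotientGroup.mk C := by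
  rw [mk_mul_mk]
  exact congrArg _ (Subtype.ext h)

lemma upper_add (x y : R) : upper (x + y) = upper x * upper y := by
  symm
  apply mk_mul_eq
  simp [upperSL, add_comm]

lemma lower_add (x y : R) : lower (x + y) = lower x * lower y := by
  symm
  apply mk_mul_eq
  simp [lowerSL]

lemma upper_zero : upper (0 : R) = 1 := by
  have h := upper_add (0 : R) 0
  rw [add_zero] at h
  exact left_eq_mul.mp h

lemma lower_zero : lower (0 : R) = 1 := by
  have h := lower_add (0 : R) 0
  rw [add_zero] at h
  exact left_eq_mul.mp h

lemma upper_neg (x : R) : upper (-x) = (upper x)⁻¹ := by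
  rw [eq_inv_iff_mul_eq_one, ← upper_add, neg_add_cancel, upper_zero]

lemma lower_neg (x : R) : lower (-x) = (lower x)⁻¹ := by
  rw [eq_inv_iff_mul_eq_one, ← lower_add, neg_add_cancel, lower_zero]

lemma upper_nsmul (n : ℕ) (x : R) : upper (n • x) = upper x ^ n := by
  induction n with
  | zero => simp [upper_zero]
  | succ n ih => rw [succ_nsmul, upper_add, ih, pow_succ]

lemma lower_nsmul (n : ℕ) (x : R) : lower (n • x) = lower x ^ n := by
  induction n with
  | zero => simp [lower_zero]
  | succ n ih => rw [succ_nsmul, lower_add, ih, pow_succ]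

lemma weyl_mul_upper (x : R) : weyl * upper x = lower (-x) * weyl := by
  rw [weyl, upper, lower, mk_mul_mk]
  symm
  apply mk_mul_eq
  simp only [Matrix.SpecialLinearGroup.coe_mul]
  simp [upperSL, lowerSL, weylSL]

lemma weyl_conj_upper (x : R) : weyl * upper x * weyl⁻¹ = lower (-x) := by
  rw [weyl_mul_upper, mul_inv_cancel_right]

lemma weyl_mul_weyl : weyl * weyl = (1 : PSL(2, R)) := by
  rw [weyl, mk_mul_mk, QuotientGroup.eq_one_iff,
    Matrix.SpecialLinearGroup.mem_center_iff]
  refine ⟨-1, by simp, ?_⟩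
  simp only [Matrix.SpecialLinearGroup.coe_mul]
  ext i j
  fin_cases i <;> fin_cases j <;> simp [weylSL]

lemma weyl_inv : (weyl : PSL(2, R))⁻¹ = weyl :=
  inv_eq_of_mul_eq_one_right weyl_mul_weyl

lemma mk_transferSL (x : R) :
    (QuotientGroup.mk (transferSL x) : PSL(2, R)) = upper x * weyl := by
  symm
  apply mk_mul_eq
  simp [upperSL, weylSL, transferSL]

end Generators

/-! ### Generation and normal subgroups of PSL₂ over a field -/

section Field

variable {F : Type*} [Field F]

lemma mk_eq_of_ne_zero (g : SL(2, F)) (hc : g.1 1 0 ≠ 0) :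
    (QuotientGroup.mk g : PSL(2, F)) =
      upper ((g.1 0 0 - 1) / g.1 1 0) * lower (g.1 1 0) * upper ((g.1 1 1 - 1) / g.1 1 0) := by
  have hdet := g.2
  rw [Matrix.det_fin_two] at hdet
  rw [upper, upper, lower, mk_mul_mk]
  symm
  apply mk_mul_eq
  simp only [Matrix.SpecialLinearGroup.coe_mul]
  ext i j
  fin_cases i <;> fin_cases j <;> simp [upperSL, lowerSL] <;> field_simp
  · ring
  · linear_combination hdet
  · ring

lemma eq_top_of_upper_lower_mem {K : Subgroup PSL(2, F)} (hu : ∀ x, upper x ∈ K)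
    (hl : ∀ x, lower x ∈ K) : K = ⊤ := by
  rw [eq_top_iff]
  rintro g -
  induction g using QuotientGroup.induction_on with
  | H g =>
    have main : ∀ g : SL(2, F), g.1 1 0 ≠ 0 → (QuotientGroup.mk g : PSL(2, F)) ∈ K := by
      intro g hc
      rw [mk_eq_of_ne_zero g hc]
      exact mul_mem (mul_mem (hu _) (hl _)) (hu _)
    by_cases hc : g.1 1 0 = 0
    · have hdet := g.2
      rw [Matrix.det_fin_two, hc, mul_zero, sub_zero] at hdet
      have ha : g.1 0 0 ≠ 0 := left_ne_zero_of_mul_eq_one hdet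
      -- Adding the first row to the second makes the lower left entry equal to the nonzero upper
      -- left one.
      rw [← mul_mem_cancel_left (hl 1), lower, mk_mul_mk]
      apply main
      rw [Matrix.SpecialLinearGroup.coe_mul]
      simpa [lowerSL, Matrix.mul_apply, Fin.sum_univ_two, hc] using ha
    · exact main g hc

/-- The diagonal matrix with entries `x` and `x⁻¹`. -/
def diagSL (x : F) (hx : x ≠ 0) : SL(2, F) :=
  ⟨!![x, 0; 0, x⁻¹], by simp [Matrix.det_fin_two, hx]⟩

/-- The image in `PSL₂` of the diagonal matrix with entries `x` and `x⁻¹`. -/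
def diag (x : F) (hx : x ≠ 0) : PSL(2, F) :=
  QuotientGroup.mk (diagSL x hx)

lemma diag_conj_upper (x : F) (hx : x ≠ 0) (t : F) :
    diag x hx * upper t * (diag x hx)⁻¹ = upper (x ^ 2 * t) := by
  rw [mul_inv_eq_iff_eq_mul, diag, upper, upper, mk_mul_mk]
  apply mk_mul_eq
  simp only [Matrix.SpecialLinearGroup.coe_mul]
  simp [upperSL, diagSL]
  field_simp

lemma eq_top_of_upper_mem {N : Subgroup PSL(2, F)} [N.Normal] (hu : ∀ x, upper x ∈ N) :
    N = ⊤ := by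
  refine eq_top_of_upper_lower_mem hu fun x => ?_
  rw [← neg_neg x, ← weyl_conj_upper]
  exact Normal.conj_mem inferInstance _ (hu _) _

/-- The commutator of diag(2, 1/2) with `upper t` is `upper (4t - t)`, so dividing by 3 reaches
every upper unipotent. -/
lemma eq_top_of_commutator_upper_mem (h2 : (2 : F) ≠ 0) (h3 : (3 : F) ≠ 0)
    {N : Subgroup PSL(2, F)} [N.Normal]
    (h : ∀ g t, g * upper t * g⁻¹ * (upper t)⁻¹ ∈ N) : N = ⊤ := by
  refine eq_top_of_upper_mem fun x => ?_
  have := h (diag 2 h2) (x / 3)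
  rw [diag_conj_upper, ← upper_neg, ← upper_add] at this
  convert this using 2
  field_simp
  ring

lemma commutator_eq_top (h2 : (2 : F) ≠ 0) (h3 : (3 : F) ≠ 0) :
    commutator PSL(2, F) = ⊤ :=
  eq_top_of_commutator_upper_mem h2 h3 fun g t =>
    commutator_mem_commutator (mem_top g) (mem_top (upper t))

/-- Modulo N, the centralizer of `upper t` contains the upper unipotents and the powers of `lower
s`, hence everything. -/
lemma eq_top_of_commutator_lower_upper_mem (h2 : (2 : F) ≠ 0) (h3 : (3 : F) ≠ 0)
    {N : Subgroup PSL(2, F)} [N.Normal]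
    {s : F} (hs : ∀ x, ∃ n : ℕ, n • s = x) (h : ∀ t, lower s * upper t * (lower s)⁻¹ * (upper t)⁻¹ ∈ N) : N = ⊤ := by
  have comm_iff : ∀ g t, g ∈ (centralizer {(upper t : PSL(2, F) ⧸ N)}).comap
      (QuotientGroup.mk' N) ↔ g * upper t * g⁻¹ * (upper t)⁻¹ ∈ N := by
    intro g t
    rw [mem_comap, mem_centralizer_singleton_iff, ← QuotientGroup.eq_one_iff]
    simp only [QuotientGroup.mk_mul, QuotientGroup.mk_inv, QuotientGroup.mk'_apply]
    rw [mul_inv_eq_one, mul_inv_eq_iff_eq_mul]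
  refine eq_top_of_commutator_upper_mem h2 h3 fun g t => ?_
  rw [← comm_iff, eq_top_of_upper_lower_mem
    (K := (centralizer {(upper t : PSL(2, F) ⧸ N)}).comap (QuotientGroup.mk' N))]
  · exact mem_top _
  · intro x
    rw [comm_iff, ← upper_add, add_comm, upper_add, mul_inv_cancel_right, mul_inv_cancel]
    exact one_mem _
  · intro x
    obtain ⟨n, rfl⟩ := hs x
    rw [lower_nsmul]
    exact pow_mem ((comm_iff _ _).mpr (h t)) n

end Field

/-! ### Subgroups of products and words in two letters -/

section Group

/-- The elements `x` of the first factor for which `(x, 1)` lies in a subgroup of a product. -/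
def fstKernel {G H : Type*} [Group G] [Group H] (K : Subgroup (G × H)) : Subgroup G :=
  K.comap (MonoidHom.inl G H)

lemma fstKernel_normal {G H : Type*} [Group G] [Group H] {K : Subgroup (G × H)}
    (h : ∀ x, ∃ y, (x, y) ∈ K) : (fstKernel K).Normal := by
  refine ⟨fun n hn g => ?_⟩
  obtain ⟨y, hy⟩ := h g
  have := mul_mem (mul_mem hy hn) (inv_mem hy)
  simpa [fstKernel] using this

/-- Induction on the set J of coordinates to be killed: a commutator of an element trivial on J with
one trivial at j is trivial on both, and by perfectness such commutators generate the factor at i.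
-/
lemma eq_top_of_pairwise {ι : Type*} [Finite ι] [DecidableEq ι] {G : ι → Type*}
    [∀ i, Group (G i)] (hG : ∀ i, commutator (G i) = ⊤) {K : Subgroup (∀ i, G i)}
    (hsurj : ∀ i x, ∃ g ∈ K, g i = x)
    (hK : ∀ i j, i ≠ j → ∀ x, ∃ g ∈ K, g i = x ∧ g j = 1) : K = ⊤ := by
  have := Fintype.ofFinite ι
  have key : ∀ (i : ι) (J : Finset ι), i ∉ J → ∀ x, ∃ g ∈ K, g i = x ∧ ∀ j ∈ J, g j = 1 := by
    intro i J
    induction J using Finset.induction_on with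
    | empty =>
      intro _ x
      obtain ⟨g, hg, h⟩ := hsurj i x
      exact ⟨g, hg, h, by simp⟩
    | insert j J _ ih =>
      intro hi x
      rw [Finset.mem_insert, not_or] at hi
      let M : Subgroup (∀ i, G i) :=
        K ⊓ Subgroup.pi ((insert j J : Finset ι) : Set ι) (fun _ => ⊥)
      have hM : M.map (Pi.evalMonoidHom G i) = ⊤ := by
        rw [eq_top_iff, ← hG i, commutator_def, commutator_le]
        intro a _ b _
        obtain ⟨g, hg, rfl, hgJ⟩ := ih hi.2 a
        obtain ⟨h, hh, rfl, hhj⟩ := hK i j hi.1 b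
        refine ⟨g * h * g⁻¹ * h⁻¹, ⟨?_, ?_⟩, rfl⟩
        · exact K.mul_mem (K.mul_mem (K.mul_mem hg hh) (K.inv_mem hg)) (K.inv_mem hh)
        · intro l hl
          rcases Finset.mem_insert.mp (Finset.mem_coe.mp hl) with rfl | hl
          · simp [hhj]
          · simp [hgJ l hl]
      obtain ⟨g, hg, rfl⟩ := hM.ge (mem_top x)
      exact ⟨g, hg.1, rfl, fun l hl => hg.2 l hl⟩
  rw [eq_top_iff]
  intro f _
  refine pi_mem_of_mulSingle_mem f fun i => ?_
  obtain ⟨g, hg, hgi, hgJ⟩ := key i (Finset.univ.erase i) (by simp) (f i)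
  convert hg
  ext j
  by_cases hj : j = i
  · subst hj
    simp [hgi]
  · simp [Pi.mulSingle_eq_of_ne hj, hgJ j (by simp [hj])]

variable {G : Type*} [Group G] (A B : G)

lemma words_two_mem : A * B⁻¹ ∈ ({A, B} : Set G) ^ 2 * ({A, B} : Set G)⁻¹ ^ 2 ∧
    A * (A * B⁻¹) * A⁻¹ ∈ ({A, B} : Set G) ^ 2 * ({A, B} : Set G)⁻¹ ^ 2 := by
  have hA : A ∈ ({A, B} : Set G) := by simp
  have hB : B ∈ ({A, B} : Set G) := by simp
  have hA' := Set.inv_mem_inv.mpr hA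
  have hB' := Set.inv_mem_inv.mpr hB
  simp only [pow_two]
  constructor
  · convert Set.mul_mem_mul (Set.mul_mem_mul hA hA) (Set.mul_mem_mul hA' hB') using 1
    group
  · convert Set.mul_mem_mul (Set.mul_mem_mul hA hA) (Set.mul_mem_mul hB' hA') using 1
    group

lemma words_three_mem : A * B⁻¹ ∈ ({A, B} : Set G) ^ 3 * ({A, B} : Set G)⁻¹ ^ 3 ∧
    A * (A * B⁻¹) * A⁻¹ ∈ ({A, B} : Set G) ^ 3 * ({A, B} : Set G)⁻¹ ^ 3 ∧
    A * (A * (A * B⁻¹) * A⁻¹) * A⁻¹ ∈ ({A, B} : Set G) ^ 3 * ({A, B} : Set G)⁻¹ ^ 3 := by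
  have hA : A ∈ ({A, B} : Set G) := by simp
  have hB : B ∈ ({A, B} : Set G) := by simp
  have hA' := Set.inv_mem_inv.mpr hA
  have hB' := Set.inv_mem_inv.mpr hB
  simp only [pow_succ, pow_zero, one_mul]
  refine ⟨?_, ?_, ?_⟩
  · convert Set.mul_mem_mul (Set.mul_mem_mul (Set.mul_mem_mul hA hA) hA)
      (Set.mul_mem_mul (Set.mul_mem_mul hA' hA') hB') using 1
    group
  · convert Set.mul_mem_mul (Set.mul_mem_mul (Set.mul_mem_mul hA hA) hA)
      (Set.mul_mem_mul (Set.mul_mem_mul hA' hB') hA') using 1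
    group
  · convert Set.mul_mem_mul (Set.mul_mem_mul (Set.mul_mem_mul hA hA) hA)
      (Set.mul_mem_mul (Set.mul_mem_mul hB' hA') hA') using 1
    group

lemma inv_pair : ({A, B} : Set G)⁻¹ = {A⁻¹, B⁻¹} := by
  rw [Set.inv_insert, Set.inv_singleton]

lemma words_inv_two_mem : A⁻¹ * B ∈ ({A, B} : Set G)⁻¹ ^ 2 * ({A, B} : Set G) ^ 2 ∧
    A⁻¹ * (A⁻¹ * B) * A ∈ ({A, B} : Set G)⁻¹ ^ 2 * ({A, B} : Set G) ^ 2 := by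
  simpa [inv_pair] using words_two_mem A⁻¹ B⁻¹

lemma words_inv_three_mem : A⁻¹ * B ∈ ({A, B} : Set G)⁻¹ ^ 3 * ({A, B} : Set G) ^ 3 ∧
    A⁻¹ * (A⁻¹ * B) * A ∈ ({A, B} : Set G)⁻¹ ^ 3 * ({A, B} : Set G) ^ 3 ∧
    A⁻¹ * (A⁻¹ * (A⁻¹ * B) * A) * A ∈ ({A, B} : Set G)⁻¹ ^ 3 * ({A, B} : Set G) ^ 3 := by
  simpa [inv_pair] using words_three_mem A⁻¹ B⁻¹

lemma eq_top_of_map_conj_eq_top (g : G) {K : Subgroup G}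
    (h : K.map (MulAut.conj g).toMonoidHom = ⊤) : K = ⊤ := by
  rw [eq_top_iff]
  intro x _
  obtain ⟨y, hy, hyx⟩ := h.ge (mem_top (g * x * g⁻¹))
  have : y = x := by simpa using hyx
  exact this ▸ hy

end Group

/-! ### Transfer matrices: one factor, two factors, many factors -/

section Transfer

variable {p : ℕ}

lemma transferPSL_eq (x : ZMod p) : transferPSL x = upper x * weyl :=
  mk_transferSL x

lemma transferPSL_mul_inv (x y : ZMod p) :
    transferPSL x * (transferPSL y)⁻¹ = upper (x - y) := by
  rw [transferPSL_eq, transferPSL_eq, sub_eq_add_neg, upper_add, upper_neg]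
  group

lemma weyl_conj_transferPSL_inv (x : ZMod p) :
    weyl * (transferPSL x)⁻¹ * weyl⁻¹ = transferPSL (-x) := by
  rw [transferPSL_eq, transferPSL_eq, upper_neg, weyl_inv, mul_inv_rev, weyl_inv, ← mul_assoc,
    weyl_mul_weyl, one_mul]

lemma transferPSL_conj_upper (x t : ZMod p) :
    transferPSL x * upper t * (transferPSL x)⁻¹ = upper x * lower (-t) * (upper x)⁻¹ := by
  rw [transferPSL_eq, ← weyl_conj_upper]
  group

lemma transferPSL_sq_conj_upper (x t : ZMod p) :
    transferPSL x * (transferPSL x * upper t * (transferPSL x)⁻¹) * (transferPSL x)⁻¹ =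
      upper x * (lower (-x) * upper t * (lower (-x))⁻¹) * (upper x)⁻¹ := by
  have : weyl * lower (-t) * weyl⁻¹ = (upper t : PSL(2, ZMod p)) := by
    rw [← weyl_conj_upper, weyl_inv]
    simp only [mul_assoc, weyl_mul_weyl, mul_one]
    rw [← mul_assoc, weyl_mul_weyl, one_mul]
  rw [transferPSL_conj_upper, transferPSL_eq, ← weyl_conj_upper x, ← this]
  group

lemma two_ne_zero_of_five_le (hp : 5 ≤ p) : (2 : ZMod p) ≠ 0 := by
  have h : ((2 : ℕ) : ZMod p) ≠ 0 := by
    rw [Ne, ZMod.natCast_eq_zero_iff]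
    exact fun h => absurd (Nat.le_of_dvd two_pos h) (by lia)
  exact_mod_cast h

lemma three_ne_zero_of_five_le (hp : 5 ≤ p) : (3 : ZMod p) ≠ 0 := by
  have h : ((3 : ℕ) : ZMod p) ≠ 0 := by
    rw [Ne, ZMod.natCast_eq_zero_iff]
    exact fun h => absurd (Nat.le_of_dvd three_pos h) (by lia)
  exact_mod_cast h

variable [Fact p.Prime]

lemma exists_nsmul_eq {d : ZMod p} (hd : d ≠ 0) (t : ZMod p) : ∃ n : ℕ, n • d = t := by
  refine ⟨(t / d).val, ?_⟩
  rw [nsmul_eq_mul, ZMod.natCast_zmod_val, div_mul_cancel₀ _ hd]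

lemma eq_top_of_transfer_mem {d : ZMod p} (hd : d ≠ 0) (a : ZMod p)
    {K : Subgroup PSL(2, ZMod p)} (h0 : upper d ∈ K)
    (h1 : transferPSL a * upper d * (transferPSL a)⁻¹ ∈ K) : K = ⊤ := by
  have hu : ∀ t : ZMod p, upper t ∈ K := by
    intro t
    obtain ⟨n, rfl⟩ := exists_nsmul_eq hd t
    rw [upper_nsmul]
    exact pow_mem h0 n
  refine eq_top_of_upper_lower_mem hu fun t => ?_
  rw [transferPSL_conj_upper, mul_mem_cancel_right (inv_mem (hu a)),
    mul_mem_cancel_left (hu a)] at h1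
  obtain ⟨n, rfl⟩ := exists_nsmul_eq (neg_ne_zero.mpr hd) t
  rw [lower_nsmul]
  exact pow_mem h1 n

lemma fstKernel_eq_top_of_prime_ne {q : ℕ} [Fact q.Prime] (hpq : p ≠ q) {d : ℤ}
    (hd : (d : ZMod p) ≠ 0) {K : Subgroup (PSL(2, ZMod p) × PSL(2, ZMod q))}
    (hsurj : ∀ x, ∃ y, (x, y) ∈ K) (h : (upper (d : ZMod p), upper (d : ZMod q)) ∈ K) :
    fstKernel K = ⊤ := by
  have := fstKernel_normal hsurj
  refine eq_top_of_upper_mem fun t => ?_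
  -- The q-th power is trivial in the second coordinate, yet still generates the upper unipotents in
  -- the first.
  have hqd : (q : ZMod p) * d ≠ 0 := by
    refine mul_ne_zero ?_ hd
    rw [Ne, ZMod.natCast_eq_zero_iff, Nat.prime_dvd_prime_iff_eq Fact.out Fact.out]
    exact hpq
  obtain ⟨n, hn⟩ := exists_nsmul_eq hqd t
  have := pow_mem h (q * n)
  rw [Prod.pow_mk, ← upper_nsmul, ← upper_nsmul] at this
  have e1 : (q * n) • (d : ZMod p) = t := by
    rw [← hn]
    simp only [nsmul_eq_mul, Nat.cast_mul]
    ring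
  have e2 : (q * n) • (d : ZMod q) = 0 := by simp
  rw [e1, e2, upper_zero] at this
  exact this

lemma fstKernel_eq_top_of_ne (hp : 5 ≤ p) {d : ZMod p} (hd : d ≠ 0) {a b : ZMod p} (hab : a ≠ b)
    {K : Subgroup (PSL(2, ZMod p) × PSL(2, ZMod p))}
    (h0 : (upper d, upper d) ∈ K)
    (h1 : (transferPSL a * upper d * (transferPSL a)⁻¹,
      transferPSL b * upper d * (transferPSL b)⁻¹) ∈ K)
    (h2 : (transferPSL a * (transferPSL a * upper d * (transferPSL a)⁻¹) * (transferPSL a)⁻¹,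
      transferPSL b * (transferPSL b * upper d * (transferPSL b)⁻¹) * (transferPSL b)⁻¹) ∈ K) :
    fstKernel K = ⊤ := by
  have hu : ∀ t : ZMod p, (upper t, upper t) ∈ K := by
    intro t
    obtain ⟨n, rfl⟩ := exists_nsmul_eq hd t
    rw [upper_nsmul, ← Prod.pow_mk]
    exact pow_mem h0 n
  -- Conjugating `h1` by the diagonal element `upper (-a)` leaves `lower (-d)` beside its conjugate
  -- by `upper (b - a)`.
  have graph : ∀ g, (g, upper (b - a) * g * (upper (b - a))⁻¹) ∈ K := by
    have h : K.comap ((MonoidHom.id _).prod (MulAut.conj (upper (b - a))).toMonoidHom) = ⊤ := by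
      refine eq_top_of_upper_lower_mem (fun t => ?_) fun t => ?_
      · have h : upper (b - a) * upper t * (upper (b - a))⁻¹ = upper t := by
          rw [← upper_add, add_comm, upper_add, mul_inv_cancel_right]
        change (upper t, upper (b - a) * upper t * (upper (b - a))⁻¹) ∈ K
        rw [h]
        exact hu t
      · obtain ⟨n, rfl⟩ := exists_nsmul_eq (neg_ne_zero.mpr hd) t
        rw [lower_nsmul]
        refine pow_mem ?_ n
        rw [transferPSL_conj_upper, transferPSL_conj_upper] at h1
        convert mul_mem (mul_mem (inv_mem (hu a)) h1) (hu a) using 1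
        simp [sub_eq_neg_add, upper_add, upper_neg, mul_assoc]
    exact fun g => h.ge (mem_top g)
  have := fstKernel_normal fun x => ⟨_, graph x⟩
  have key : ∀ t, lower (b - a) * upper t * (lower (b - a))⁻¹ * (upper t)⁻¹ ∈ fstKernel K := by
    intro t
    obtain ⟨n, rfl⟩ := exists_nsmul_eq hd t
    rw [transferPSL_sq_conj_upper, transferPSL_sq_conj_upper] at h2
    have h3 := mul_mem (mul_mem (inv_mem (hu a)) h2) (hu a)
    have h4 : (lower (-a) * upper (n • d) * (lower (-a))⁻¹,
        upper (b - a) * (lower (-b) * upper (n • d) * (lower (-b))⁻¹) * (upper (b - a))⁻¹) ∈ K := by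
      rw [upper_nsmul, ← conj_pow, ← conj_pow, ← conj_pow, ← Prod.pow_mk]
      refine pow_mem ?_ n
      convert h3 using 1
      simp [sub_eq_neg_add, upper_add, upper_neg, mul_assoc]
    -- The graph element is chosen with the same second coordinate as `h4`; conjugating the quotient
    -- by `lower b` turns its first coordinate into the commutator.
    have h5 := mul_mem h4 (inv_mem (graph (lower (-b) * upper (n • d) * (lower (-b))⁻¹)))
    simp only [Prod.inv_mk, Prod.mk_mul_mk, mul_inv_cancel] at h5
    have h6 := Normal.conj_mem this _ h5 (lower b)
    convert h6 using 1
    simp only [sub_eq_add_neg, lower_add, lower_neg]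
    group
  exact eq_top_of_commutator_lower_upper_mem (two_ne_zero_of_five_le hp) (three_ne_zero_of_five_le hp)
    (exists_nsmul_eq (sub_ne_zero.mpr hab.symm)) key

lemma fstKernel_eq_top {q : ℕ} [Fact q.Prime] (hp : 5 ≤ p) {d : ℤ} (hd : (d : ZMod p) ≠ 0)
    {a : ZMod p} {b : ZMod q} (hab : ∀ h : p = q, ZMod.ringEquivCongr h a ≠ b)
    {K : Subgroup (PSL(2, ZMod p) × PSL(2, ZMod q))} (hsurj : ∀ x, ∃ y, (x, y) ∈ K)
    (h0 : (upper (d : ZMod p), upper (d : ZMod q)) ∈ K)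
    (h1 : (transferPSL a * upper (d : ZMod p) * (transferPSL a)⁻¹,
      transferPSL b * upper (d : ZMod q) * (transferPSL b)⁻¹) ∈ K)
    (h2 : (transferPSL a * (transferPSL a * upper (d : ZMod p) * (transferPSL a)⁻¹) *
      (transferPSL a)⁻¹, transferPSL b * (transferPSL b * upper (d : ZMod q) *
      (transferPSL b)⁻¹) * (transferPSL b)⁻¹) ∈ K) :
    fstKernel K = ⊤ := by
  by_cases hpq : p = q
  · subst hpq
    have hab' : a ≠ b := by simpa using hab rfl
    exact fstKernel_eq_top_of_ne hp hd hab' h0 h1 h2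
  · exact fstKernel_eq_top_of_prime_ne hpq hd hsurj h0

lemma eq_top_of_transfer_tuple_mem {k : ℕ} {p : Fin k → ℕ} [∀ j, Fact (p j).Prime]
    (hp : ∀ j, 5 ≤ p j) {d : ℤ} (hd : ∀ j, (d : ZMod (p j)) ≠ 0) (a : ∀ j, ZMod (p j))
    (ha : ∀ (i j : Fin k) (h : p i = p j), i ≠ j → ZMod.ringEquivCongr h (a i) ≠ a j)
    {K : Subgroup (∀ j, PSL(2, ZMod (p j)))} {A U : ∀ j, PSL(2, ZMod (p j))}
    (hA : A = fun j => transferPSL (a j)) (hU : U = fun j => upper (d : ZMod (p j)))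
    (h0 : U ∈ K) (h1 : A * U * A⁻¹ ∈ K) (h2 : A * (A * U * A⁻¹) * A⁻¹ ∈ K) : K = ⊤ := by
  subst hA hU
  have hsurj : ∀ i x, ∃ g ∈ K, g i = x := by
    intro i x
    have h : K.map (Pi.evalMonoidHom _ i) = ⊤ :=
      eq_top_of_transfer_mem (hd i) (a i) ⟨_, h0, rfl⟩ ⟨_, h1, rfl⟩
    exact h.ge (mem_top x)
  refine eq_top_of_pairwise
    (fun i => commutator_eq_top (two_ne_zero_of_five_le (hp i)) (three_ne_zero_of_five_le (hp i)))
    hsurj fun i j hij x => ?_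
  have h : fstKernel (K.map ((Pi.evalMonoidHom _ i).prod (Pi.evalMonoidHom _ j))) = ⊤ := by
    refine fstKernel_eq_top (hp i) (hd i) (fun h => ha i j h hij) (fun x => ?_)
      ⟨_, h0, rfl⟩ ⟨_, h1, rfl⟩ ⟨_, h2, rfl⟩
    obtain ⟨g, hg, rfl⟩ := hsurj i x
    exact ⟨g j, g, hg, rfl⟩
  obtain ⟨g, hg, hgx⟩ := h.ge (mem_top x)
  exact ⟨g, hg, congrArg Prod.fst hgx, congrArg Prod.snd hgx⟩

lemma intCast_ne_zero_of_abs_lt {p : ℕ} {d : ℤ} (hd : d ≠ 0) (h : |d| < p) :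
    (d : ZMod p) ≠ 0 := by
  rw [Ne, ZMod.intCast_zmod_eq_zero_iff_dvd]
  exact fun hdvd => hd (Int.eq_zero_of_abs_lt_dvd hdvd h)

lemma transferPSL_sub_mul_inv {p : ℕ} (lam : ZMod p) (v v' : ℤ) :
    transferPSL (lam - (v : ZMod p)) * (transferPSL (lam - (v' : ZMod p)))⁻¹ = upper ((v' - v : ℤ) : ZMod p) := by
  rw [transferPSL_mul_inv]
  congr 1
  push_cast
  ring

lemma weyl_conj_transferPSL_inv_mul {p : ℕ} (lam : ZMod p) (v v' : ℤ) :
    weyl * ((transferPSL (lam - (v : ZMod p)))⁻¹ * transferPSL (lam - (v' : ZMod p))) * weyl⁻¹ =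
      upper ((v - v' : ℤ) : ZMod p) := by
  have h : weyl * transferPSL (lam - (v' : ZMod p)) * weyl⁻¹ = (transferPSL (-(lam - (v' : ZMod p))))⁻¹ := by
    rw [← weyl_conj_transferPSL_inv]
    group
  rw [← conj_mul, weyl_conj_transferPSL_inv, h, transferPSL_mul_inv]
  congr 1
  push_cast
  ring

end Transfer

end TransferPSL

open TransferPSL in
/-- Powers and products of sets are pointwise, so that for instance `S ^ 2 * S⁻¹ ^ 2` is the set of
all `g₁ g₂ g₃⁻¹ g₄⁻¹` with `gᵢ ∈ S`. The first part is the case of one prime. -/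
theorem mainTheorem8 (v v' : ℤ) (hv : v ≠ v') :
    (∀ (p : ℕ), p.Prime → max 5 (|v - v'| + 1) ≤ (p : ℤ) → ∀ lam : ZMod p,
      Subgroup.closure (genSet v v' lam ^ 2 * (genSet v v' lam)⁻¹ ^ 2) = ⊤ ∧
      Subgroup.closure ((genSet v v' lam)⁻¹ ^ 2 * genSet v v' lam ^ 2) = ⊤) ∧
    (∀ (k : ℕ) (p : Fin k → ℕ), (∀ j, (p j).Prime) →
      (∀ j, max 5 (|v - v'| + 1) ≤ (p j : ℤ)) →
      ∀ lam : (j : Fin k) → ZMod (p j),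
        (∀ (i j : Fin k) (h : p i = p j), i ≠ j → ZMod.ringEquivCongr h (lam i) ≠ lam j) →
        Subgroup.closure (genSetProd v v' lam ^ 3 * (genSetProd v v' lam)⁻¹ ^ 3) = ⊤ ∧
        Subgroup.closure ((genSetProd v v' lam)⁻¹ ^ 3 * genSetProd v v' lam ^ 3) = ⊤) := by
  constructor
  · intro p hp hpv lam
    have : Fact p.Prime := ⟨hp⟩
    have hlt : |v - v'| < p := by have := (le_max_right _ _).trans hpv; lia
    constructor
    · obtain ⟨h0, h1⟩ := words_two_mem (transferPSL (lam - (v : ZMod p)))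
        (transferPSL (lam - (v' : ZMod p)))
      rw [transferPSL_sub_mul_inv] at h0 h1
      exact eq_top_of_transfer_mem
        (intCast_ne_zero_of_abs_lt (sub_ne_zero.mpr hv.symm) (by rwa [abs_sub_comm]))
        _ (Subgroup.subset_closure h0) (Subgroup.subset_closure h1)
    · obtain ⟨h0, h1⟩ := words_inv_two_mem (transferPSL (lam - (v : ZMod p)))
        (transferPSL (lam - (v' : ZMod p)))
      refine eq_top_of_map_conj_eq_top weyl (eq_top_of_transfer_mem
        (intCast_ne_zero_of_abs_lt (sub_ne_zero.mpr hv) hlt) (-(lam - (v : ZMod p)))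
        ⟨_, Subgroup.subset_closure h0, weyl_conj_transferPSL_inv_mul _ _ _⟩
        ⟨_, Subgroup.subset_closure h1, ?_⟩)
      rw [← weyl_conj_transferPSL_inv, ← weyl_conj_transferPSL_inv_mul lam]
      simp [mul_assoc]
  · intro k p hp hpv lam hlam
    have : ∀ j, Fact (p j).Prime := fun j => ⟨hp j⟩
    have h5 : ∀ j, 5 ≤ p j := fun j => by exact_mod_cast (le_max_left _ _).trans (hpv j)
    have hlt : ∀ j, |v - v'| < p j := fun j => by
      have := (le_max_right _ _).trans (hpv j); lia
    have cast_congr : ∀ (m n : ℕ) (h : m = n) (x : ZMod m) (y : ZMod n),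
        ZMod.ringEquivCongr h x ≠ y → ZMod.ringEquivCongr h (x - (v : ZMod m)) ≠ y - (v : ZMod n) := by
      intro m n h x y hxy
      rw [map_sub, map_intCast]
      exact fun h' => hxy (sub_left_injective h')
    set A : ∀ j, PSL(2, ZMod (p j)) := fun j => transferPSL (lam j - (v : ZMod (p j))) with hA
    set B : ∀ j, PSL(2, ZMod (p j)) := fun j => transferPSL (lam j - (v' : ZMod (p j))) with hB
    constructor
    · obtain ⟨h0, h1, h2⟩ := words_three_mem A B
      refine eq_top_of_transfer_tuple_mem h5 (d := v' - v)
        (fun j => intCast_ne_zero_of_abs_lt (sub_ne_zero.mpr hv.symm) (by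
          rw [abs_sub_comm]; exact hlt j))
        (fun j => lam j - (v : ZMod (p j))) (fun i j h hij => cast_congr _ _ h _ _ (hlam i j h hij)) hA
        (U := A * B⁻¹) (funext fun j => transferPSL_sub_mul_inv _ _ _)
        (Subgroup.subset_closure h0) (Subgroup.subset_closure h1) (Subgroup.subset_closure h2)
    · obtain ⟨h0, h1, h2⟩ := words_inv_three_mem A B
      refine eq_top_of_map_conj_eq_top (fun j => weyl) (eq_top_of_transfer_tuple_mem h5
        (d := v - v') (fun j => intCast_ne_zero_of_abs_lt (sub_ne_zero.mpr hv) (hlt j))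
        (fun j => -(lam j - (v : ZMod (p j)))) (fun i j h hij => ?_)
        (A := (fun j => weyl) * A⁻¹ * (fun j => weyl)⁻¹)
        (funext fun j => weyl_conj_transferPSL_inv _)
        (U := (fun j => weyl) * (A⁻¹ * B) * (fun j => weyl)⁻¹)
        (funext fun j => weyl_conj_transferPSL_inv_mul _ _ _)
        ⟨_, Subgroup.subset_closure h0, rfl⟩ ⟨_, Subgroup.subset_closure h1, ?_⟩
        ⟨_, Subgroup.subset_closure h2, ?_⟩)
      · rw [map_neg, Ne, neg_inj]
        exact cast_congr _ _ h _ _ (hlam i j h hij)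
      · simp [mul_assoc]
      · simp [mul_assoc]
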